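/- Call an associative ring $R$ with unity *NJ-reflexive* if for all $x,y\in R$, $xRy\subseteq N(R)$ implies $yRx\subseteq J(R)$, where $N(R)$ is the set of nilpotent elements and $J(R)$ the Jacobson radical of $R$. Let $K$ be a division ring, embedded in $M_2(K)$ as the scalar matrices $aI_2$ ($a\in K$), and let $R=K+yM_2(K)[[y]]$ be the subring of the formal power series ring $M_2(K)[[y]]$ (with $y$ central) consisting of the power series whose constant coefficient is a scalar matrix. Then $J(R)=yM_2(K)[[y]]$, $R$ is a local ring, and $R$ is NJ-reflexive, but the polynomial ring $R[x]$ (with $x$ central) is not NJ-reflexive. Consequently, it is not true that $S[x]$ is NJ-reflexive for every NJ-reflexive ring $S$. -/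

import Mathlib

open Polynomial

universe u

/-- A ring `R` is NJ-reflexive if, for all `x y : R`, `xRy ⊆ N(R)` implies `yRx ⊆ J(R)`, where
`N(R)` is the set of nilpotent elements and `J(R)` is the Jacobson radical. -/
def IsNJReflexive (R : Type*) [Ring R] : Prop :=
  ∀ x y : R, (∀ r : R, IsNilpotent (x * r * y)) → ∀ r : R, y * r * x ∈ Ring.jacobson R

/-- The subring `K + y M₂(K)[[y]]` of `M₂(K)[[y]]`: the power series over `M₂(K)` whose constant
coefficient is a scalar matrix `a · I₂` with `a ∈ K`. -/
noncomputable def scalarConstSeries (K : Type*) [DivisionRing K] :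
    Subring (PowerSeries (Matrix (Fin 2) (Fin 2) K)) :=
  (Matrix.scalar (Fin 2) : K →+* Matrix (Fin 2) (Fin 2) K).range.comap
    (PowerSeries.constantCoeff (R := Matrix (Fin 2) (Fin 2) K))

/-- The elements of `scalarConstSeries K` are exactly the series `a + y g` with `a ∈ K` (a scalar
matrix) and `g ∈ M₂(K)[[y]]`. -/
theorem mem_scalarConstSeries_iff {K : Type*} [DivisionRing K]
    (f : PowerSeries (Matrix (Fin 2) (Fin 2) K)) :
    f ∈ scalarConstSeries K ↔ ∃ (a : K) (g : PowerSeries (Matrix (Fin 2) (Fin 2) K)),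
      f = PowerSeries.C (Matrix.scalar (Fin 2) a) + PowerSeries.X * g := by
  constructor
  · rintro ⟨a, ha⟩
    refine ⟨a, PowerSeries.mk fun n => PowerSeries.coeff (n + 1) f, ?_⟩
    ext1 n
    cases n with
    | zero => simpa using ha.symm
    | succ n => simp [PowerSeries.coeff_succ_X_mul]
  · rintro ⟨a, g, rfl⟩
    exact ⟨a, by simp⟩

/-! A series in `R` with nonzero constant coefficient is a unit, so `R` is local with radical
`yM₂(K)[[y]]`; if `f` and `g` both lie outside it, `f * 1 * g` is a unit, hence not nilpotent. In
`R[x]`, a constant in the radical must be nilpotent. Put `eᵢⱼ = yEᵢⱼ`. Since `e₁₁e₀₀ = 0`, every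
element of `e₀₀R[x]e₁₁` squares to zero, yet `e₁₁e₁₀e₀₀ = y³E₁₀` has the non-nilpotent left multiple
`y⁴E₀₀`. -/

theorem mem_ringJacobson_iff {R : Type*} [Ring R] {x : R} :
    x ∈ Ring.jacobson R ↔ ∀ y, ∃ z, z * (y * x + 1) = 1 := by
  rw [← Ideal.jacobson_bot, Ideal.mem_jacobson_iff]
  simp [mul_add, sub_eq_zero, mul_assoc]

/-- If `1 + aX` has a left inverse in `R[X]`, then `a` is nilpotent. -/
theorem isNilpotent_of_mul_C_mul_X_add_one {R : Type*} [Ring R] {a : R} {q : R[X]}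
    (h : q * (C a * X + 1) = 1) : IsNilpotent a := by
  -- A left inverse must be the geometric series of `-aX`; as a polynomial it terminates.
  have hcoeff : ∀ n, q.coeff n = (-a) ^ n := by
    intro n
    induction n with
    | zero => simpa [mul_add, ← mul_assoc] using congrArg (coeff · 0) h
    | succ n ih =>
      have hn := congrArg (coeff · (n + 1)) h
      simp only [mul_add, ← mul_assoc, mul_one, coeff_add, coeff_mul_X, coeff_mul_C,
        coeff_one, Nat.succ_ne_zero, if_false, ih] at hn
      rw [pow_succ, mul_neg]
      exact eq_neg_of_add_eq_zero_right hn
  have hnil : IsNilpotent (-a) :=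
    ⟨q.natDegree + 1, by rw [← hcoeff, coeff_eq_zero_of_natDegree_lt (Nat.lt_succ_self _)]⟩
  simpa using hnil.neg

namespace scalarConstSeries

variable {K : Type*} [DivisionRing K]

/-- The series `yⁿ⁺¹ M`, for a matrix `M`, as an element of `K + y M₂(K)[[y]]`. -/
noncomputable def yPowMul (n : ℕ) (M : Matrix (Fin 2) (Fin 2) K) : scalarConstSeries K :=
  ⟨PowerSeries.X ^ (n + 1) * PowerSeries.C M,
    (mem_scalarConstSeries_iff _).2 ⟨0, PowerSeries.X ^ n * PowerSeries.C M, by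
      rw [map_zero, map_zero, zero_add, pow_succ', mul_assoc]⟩⟩

theorem isUnit_of_constantCoeff_ne_zero (f : scalarConstSeries K)
    (hf : PowerSeries.constantCoeff f.1 ≠ 0) : IsUnit f := by
  obtain ⟨a, ha⟩ := f.2
  have ha0 : a ≠ 0 := by
    rintro rfl
    exact hf (by simpa using ha.symm)
  let u : (Matrix (Fin 2) (Fin 2) K)ˣ :=
    Units.map (Matrix.scalar (Fin 2) : K →+* Matrix (Fin 2) (Fin 2) K).toMonoidHom
      (Units.mk0 a ha0)
  have hu : PowerSeries.constantCoeff f.1 = u := ha.symm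
  -- The inverse series stays in the subring because its constant coefficient is the scalar `a⁻¹`.
  let g : scalarConstSeries K := ⟨PowerSeries.invOfUnit f.1 u, a⁻¹, by
    rw [PowerSeries.constantCoeff_invOfUnit]; rfl⟩
  exact ⟨⟨f, g, Subtype.ext (PowerSeries.mul_invOfUnit _ _ hu),
    Subtype.ext (PowerSeries.invOfUnit_mul _ _ hu)⟩, rfl⟩

theorem mem_jacobson_iff_constantCoeff (f : scalarConstSeries K) :
    f ∈ Ring.jacobson (scalarConstSeries K) ↔ PowerSeries.constantCoeff f.1 = 0 := by
  constructor
  · intro hf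
    by_contra h
    exact (Ring.jacobson_lt_top (scalarConstSeries K)).ne
      (Ideal.eq_top_of_isUnit_mem _ hf (isUnit_of_constantCoeff_ne_zero f h))
  · intro hf
    refine mem_ringJacobson_iff.2 fun g => ?_
    exact (isUnit_of_constantCoeff_ne_zero (g * f + 1) (by simp [hf])).exists_left_inv

theorem mem_jacobson_iff (f : scalarConstSeries K) :
    f ∈ Ring.jacobson (scalarConstSeries K) ↔
      ∃ g : PowerSeries (Matrix (Fin 2) (Fin 2) K),
        (f : PowerSeries (Matrix (Fin 2) (Fin 2) K)) = PowerSeries.X * g := by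
  rw [mem_jacobson_iff_constantCoeff, ← PowerSeries.X_dvd_iff]
  rfl

theorem isLocalRing : IsLocalRing (scalarConstSeries K) := by
  refine .of_isUnit_or_isUnit_one_sub_self fun f => ?_
  by_cases hf : PowerSeries.constantCoeff f.1 = 0
  · exact .inr (isUnit_of_constantCoeff_ne_zero _ (by simp [hf]))
  · exact .inl (isUnit_of_constantCoeff_ne_zero _ hf)

theorem isNJReflexive : IsNJReflexive (scalarConstSeries K) := by
  intro f g h r
  by_cases hf : PowerSeries.constantCoeff f.1 = 0
  · exact Ideal.mul_mem_left _ _ ((mem_jacobson_iff_constantCoeff f).2 hf)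
  by_cases hg : PowerSeries.constantCoeff g.1 = 0
  · exact Ideal.mul_mem_right _ _
      (Ideal.mul_mem_right _ _ ((mem_jacobson_iff_constantCoeff g).2 hg))
  have hunit : IsUnit (f * 1 * g) := by
    rw [mul_one]
    exact (isUnit_of_constantCoeff_ne_zero f hf).mul (isUnit_of_constantCoeff_ne_zero g hg)
  exact absurd (h 1) hunit.not_isNilpotent

theorem yPowMul_mul_yPowMul (m n : ℕ) (M N : Matrix (Fin 2) (Fin 2) K) :
    yPowMul m M * yPowMul n N = yPowMul (m + n + 1) (M * N) := by
  apply Subtype.ext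
  change PowerSeries.X ^ (m + 1) * PowerSeries.C M * (PowerSeries.X ^ (n + 1) * PowerSeries.C N) =
    PowerSeries.X ^ (m + n + 1 + 1) * PowerSeries.C (M * N)
  rw [mul_assoc, ← mul_assoc (PowerSeries.C M),
    ((PowerSeries.commute_X (PowerSeries.C M)).pow_right (n + 1)).eq, map_mul, mul_assoc,
    ← mul_assoc, ← pow_add]
  congr 2
  ring

theorem yPowMul_zero (n : ℕ) : yPowMul n (0 : Matrix (Fin 2) (Fin 2) K) = 0 :=
  Subtype.ext (show PowerSeries.X ^ (n + 1) * PowerSeries.C 0 = 0 by rw [map_zero, mul_zero])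

/-- As `y` is central, the `n`-th power is `y^((m+1)n) Mⁿ`, from which `Mⁿ` can be read off as a
coefficient. -/
theorem not_isNilpotent_yPowMul (m : ℕ) {M : Matrix (Fin 2) (Fin 2) K} (hM : ¬ IsNilpotent M) :
    ¬ IsNilpotent (yPowMul m M) := by
  rintro ⟨n, hn⟩
  refine hM ⟨n, ?_⟩
  have h : (PowerSeries.X ^ (m + 1) * PowerSeries.C M) ^ n = 0 := congrArg Subtype.val hn
  rw [((PowerSeries.commute_X (PowerSeries.C M)).pow_right (m + 1)).symm.mul_pow, ← pow_mul,
    ← map_pow] at h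
  have hcoeff := PowerSeries.coeff_X_pow_mul (PowerSeries.C (M ^ n)) ((m + 1) * n) 0
  rw [h, zero_add] at hcoeff
  rw [← PowerSeries.constantCoeff_C (M ^ n), ← PowerSeries.coeff_zero_eq_constantCoeff_apply,
    ← hcoeff, map_zero]

theorem not_isNilpotent_single :
    ¬ IsNilpotent (Matrix.single 0 0 1 : Matrix (Fin 2) (Fin 2) K) := by
  have hidem : IsIdempotentElem (Matrix.single 0 0 1 : Matrix (Fin 2) (Fin 2) K) := by
    simp [IsIdempotentElem]
  rintro ⟨n, hn⟩
  have h0 : (Matrix.single 0 0 1 : Matrix (Fin 2) (Fin 2) K) = 0 := by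
    rw [← hidem.pow_succ_eq n, pow_succ, hn, zero_mul]
  simpa using congrFun (congrFun h0 0) 0

theorem not_isNJReflexive_polynomial : ¬ IsNJReflexive (scalarConstSeries K)[X] := by
  intro hR
  let e (i j : Fin 2) : scalarConstSeries K := yPowMul 0 (Matrix.single i j 1)
  have hzero : e 1 1 * e 0 0 = 0 := by
    rw [yPowMul_mul_yPowMul, Matrix.single_mul_single_of_ne _ _ _ _ (by decide), yPowMul_zero]
  -- The factor `e 0 1` turns the nilpotent `E₁₀` into the idempotent `E₀₀`.
  have hprod : e 0 1 * (e 1 1 * e 1 0 * e 0 0) = yPowMul 3 (Matrix.single 0 0 1) := by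
    simp only [e, yPowMul_mul_yPowMul, Matrix.single_mul_single_same, mul_one, zero_add]
  have hnil : ∀ r : (scalarConstSeries K)[X], IsNilpotent (C (e 0 0) * r * C (e 1 1)) := by
    intro r
    refine ⟨2, ?_⟩
    calc (C (e 0 0) * r * C (e 1 1)) ^ 2
        = C (e 0 0) * r * (C (e 1 1) * C (e 0 0)) * (r * C (e 1 1)) := by
          simp only [pow_two, mul_assoc]
      _ = 0 := by rw [← C_mul, hzero, C_0, mul_zero, zero_mul]
  -- The multiplier carries `X` so that the left-invertible element has the form `1 + aX` with `a =
  -- y⁴E₀₀`.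
  obtain ⟨q, hq⟩ := mem_ringJacobson_iff.1 (hR _ _ hnil (C (e 1 0))) (C (e 0 1) * X)
  rw [mul_assoc (C (e 0 1)), X_mul, ← mul_assoc, ← C_mul, ← C_mul, ← C_mul, hprod] at hq
  exact not_isNilpotent_yPowMul 3 not_isNilpotent_single (isNilpotent_of_mul_C_mul_X_add_one hq)

end scalarConstSeries

theorem mainTheorem10 {K : Type u} [DivisionRing K] :
    (∀ f : scalarConstSeries K, f ∈ Ring.jacobson (scalarConstSeries K) ↔
      ∃ g : PowerSeries (Matrix (Fin 2) (Fin 2) K),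
        (f : PowerSeries (Matrix (Fin 2) (Fin 2) K)) = PowerSeries.X * g) ∧
    IsLocalRing (scalarConstSeries K) ∧
    IsNJReflexive (scalarConstSeries K) ∧
    ¬ IsNJReflexive (scalarConstSeries K)[X] ∧
    ¬ ∀ (S : Type u) [Ring S], IsNJReflexive S → IsNJReflexive S[X] :=
  ⟨scalarConstSeries.mem_jacobson_iff, scalarConstSeries.isLocalRing,
    scalarConstSeries.isNJReflexive, scalarConstSeries.not_isNJReflexive_polynomial,
    fun h => scalarConstSeries.not_isNJReflexive_polynomial (K := K)
      (h _ scalarConstSeries.isNJReflexive)⟩
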